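/- Let $\mathcal G(V,E)$ be a finite directed graph. A distributed system $G$ over $\mathcal G$ has, at times $t\in\mathbb N_0=\{0,1,2,\dots\}$, temporal states $x^{(k)}(t)\in\mathbb R^{n^{(k)}(t)}$, inputs $u^{(k)}(t)\in\mathbb R^{n_u^{(k)}(t)}$, outputs $y^{(k)}(t)\in\mathbb R^{n_y^{(k)}(t)}$ ($k\in V$) and spatial states $x^{(ij)}(t)\in\mathbb R^{n^{(ij)}(t)}$ ($(i,j)\in E$), with all dimensions in $\mathbb N_0$ and possibly depending on $t$. Let $x_{\rm in}^{(k)}(t)$ and $x_{\rm out}^{(k)}(t)$ be the vectors obtained by stacking the $x^{(ik)}(t)$, $(i,k)\in E$, and the $x^{(kj)}(t)$, $(k,j)\in E$, respectively. The system starts from zero initial states and evolves by $$\begin{bmatrix}x^{(k)}(t+1)\\ x^{(k)}_{\rm out}(t+1)\end{bmatrix}=A^{(k)}(t)\begin{bmatrix}x^{(k)}(t)\\ x^{(k)}_{\rm in}(t)\end{bmatrix}+B^{(k)}(t)u^{(k)}(t),\qquad y^{(k)}(t)=C^{(k)}(t)\begin{bmatrix}x^{(k)}(t)\\ x^{(k)}_{\rm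 in}(t)\end{bmatrix}+D^{(k)}(t)u^{(k)}(t),$$ with real matrices $A^{(k)}(t),B^{(k)}(t),C^{(k)}(t),D^{(k)}(t)$ that are bounded uniformly in $k,t$. For a family of square matrices $X^{(k)}(t),X^{(ij)}(t)$ of sizes $n^{(k)}(t),n^{(ij)}(t)$ write $X^{(k)}_{\rm in}(t)=\mathrm{diag}(X^{(ik)}(t))_{(i,k)\in E}$ and $X^{(k)}_{\rm out}(t)=\mathrm{diag}(X^{(kj)}(t))_{(k,j)\in E}$. Assume that the realization is balanced: there are $\beta>0$ and diagonal matrices $\Sigma^{(k)}(t)\succ\beta I$, $\Sigma^{(ij)}(t)\succ\beta I$ ($t\in\mathbb N_0$, $k\in V$, $(i,j)\in E$), bounded uniformly, such that for all $(t,k)\in\mathbb N_0\times V$ $$A^{(k)}(t)\begin{bmatrix}\Sigma^{(k)}(t)&0\\0&\Sigma^{(k)}_{\rm in}(t)\end{bmatrix}A^{(k)}(t)^T-\begin{bmatrix}\Sigma^{(k)}(t+1)&0\\0&\Sigma^{(k)}_{\rm out}(t+1)\end{bmatrix}+B^{(k)}(t)B^{(k)}(t)^T\prec-\beta I,$$ $$A^{(k)}(t)^T\begin{bmatrix}\Sigma^{(k)}(t+1)&0\\0&\Sigma^{(k)}_{\rm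 out}(t+1)\end{bmatrix}A^{(k)}(t)-\begin{bmatrix}\Sigma^{(k)}(t)&0\\0&\Sigma^{(k)}_{\rm in}(t)\end{bmatrix}+C^{(k)}(t)^TC^{(k)}(t)\prec-\beta I.$$ Let $0\le r^{(k)}(t)\le n^{(k)}(t)$ and $0\le r^{(ij)}(t)\le n^{(ij)}(t)$ be integers, and partition $\Sigma^{(k)}(t)=\mathrm{diag}(\Gamma^{(k)}(t),\Omega^{(k)}(t))$ and $\Sigma^{(ij)}(t)=\mathrm{diag}(\Gamma^{(ij)}(t),\Omega^{(ij)}(t))$ with $\Gamma^{(k)}(t)$ and $\Gamma^{(ij)}(t)$ of sizes $r^{(k)}(t)$ and $r^{(ij)}(t)$. Let $G_r$ be the distributed system over the same graph whose realization is obtained from that of $G$ by keeping, in every block, only the rows and columns of $A^{(k)}(t),B^{(k)}(t),C^{(k)}(t)$ that belong to the $\Gamma$-parts, and keeping $D^{(k)}(t)$. Assume that at least one state variable is truncated, i.e. $r^{(k)}(t)<n^{(k)}(t)$ for some $(t,k)$ or $r^{(ij)}(t)<n^{(ij)}(t)$ for some $t$ and $(i,j)$. Let $\Omega$ be the (possibly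 infinite) block-diagonal matrix whose diagonal blocks are all $\Omega^{(k)}(t)$ and $\Omega^{(ij)}(t)$, $t\in\mathbb N_0$, $k\in V$, $(i,j)\in E$, and let $\zeta(\Omega)\in(0,\infty]$ be the sum of its distinct diagonal entries. Then $$\|G-G_r\|<2\,\zeta(\Omega),$$ where $\|G-G_r\|=\sup_{0\ne u\in\ell_2}\|y-y_r\|_2/\|u\|_2$, $y$ and $y_r$ are the outputs of $G$ and $G_r$ for the input $u$, and $\|w\|_2=\bigl(\sum_{(t,k)}w^{(k)}(t)^Tw^{(k)}(t)\bigr)^{1/2}$. (If $\zeta(\Omega)=\infty$, the inequality says that $\|G-G_r\|$ is finite.) -/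

import Mathlib

open scoped ENNReal Matrix Matrix.Norms.L2Operator

namespace DistSys

/-! A directed graph is given by a finite vertex type `V` and a finite set `E : Finset (V × V)` of
ordered pairs; `(i, j) ∈ E` is an edge from `i` to `j`. The dimension of the temporal state of
vertex `k` at time `t` is `n k t`, that of the spatial state of edge `e` at time `t` is `nE e t`. -/

section Graph

variable {V : Type*} [DecidableEq V] {E : Finset (V × V)}

/-- Edges entering the vertex `k`. -/
abbrev InEdge (E : Finset (V × V)) (k : V) : Type _ := {e : E // e.1.2 = k}

/-- Edges leaving the vertex `k`. -/
abbrev OutEdge (E : Finset (V × V)) (k : V) : Type _ := {e : E // e.1.1 = k}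

/-- Coordinates of the stacked vector `(x^(k)(t), x_in^(k)(t))`. -/
abbrev InIdx (n : V → ℕ → ℕ) (nE : E → ℕ → ℕ) (k : V) (t : ℕ) : Type _ :=
  Fin (n k t) ⊕ (Σ e : InEdge E k, Fin (nE e.1 t))

/-- Coordinates of the stacked vector `(x^(k)(t), x_out^(k)(t))`. -/
abbrev OutIdx (n : V → ℕ → ℕ) (nE : E → ℕ → ℕ) (k : V) (t : ℕ) : Type _ :=
  Fin (n k t) ⊕ (Σ e : OutEdge E k, Fin (nE e.1 t))

end Graph

/-- A signal: a map `(t, k) ↦ w^(k)(t) ∈ ℝ^(d k t)`. -/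
abbrev Signal {V : Type*} (d : V → ℕ → ℕ) : Type _ := ∀ (k : V) (t : ℕ), Fin (d k t) → ℝ

/-- The `ℓ₂`-norm of a signal, with value `∞` when the signal is not in `ℓ₂`. -/
noncomputable def l2norm {V : Type*} {d : V → ℕ → ℕ} (w : Signal d) : ℝ≥0∞ :=
  (∑' p : ℕ × V, ENNReal.ofReal (w p.2 p.1 ⬝ᵥ w p.2 p.1)) ^ (1 / 2 : ℝ)

/-- The `ℓ₂`-induced norm `sup_{0 ≠ u ∈ ℓ₂} ‖T u‖₂ / ‖u‖₂`, with value `∞` if unbounded. -/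
noncomputable def inducedNorm {V : Type*} {d d' : V → ℕ → ℕ} (T : Signal d → Signal d') : ℝ≥0∞ :=
  ⨆ (u : Signal d) (_ : u ≠ 0 ∧ l2norm u ≠ ∞), l2norm (T u) / l2norm u

/-- A realization of a distributed system over the graph `(V, E)` with the given dimensions. -/
structure Realization {V : Type*} [DecidableEq V] (E : Finset (V × V)) (n : V → ℕ → ℕ)
    (nE : E → ℕ → ℕ) (nu ny : V → ℕ → ℕ) where
  A : ∀ (k : V) (t : ℕ), Matrix (OutIdx n nE k (t + 1)) (InIdx n nE k t) ℝ
  B : ∀ (k : V) (t : ℕ), Matrix (OutIdx n nE k (t + 1)) (Fin (nu k t)) ℝ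
  C : ∀ (k : V) (t : ℕ), Matrix (Fin (ny k t)) (InIdx n nE k t) ℝ
  D : ∀ (k : V) (t : ℕ), Matrix (Fin (ny k t)) (Fin (nu k t)) ℝ

section Defs

variable {V : Type*} [DecidableEq V] {E : Finset (V × V)}
  {n : V → ℕ → ℕ} {nE : E → ℕ → ℕ} {nu ny : V → ℕ → ℕ}

/-- All temporal and all spatial states at time `t`. -/
abbrev State (n : V → ℕ → ℕ) (nE : E → ℕ → ℕ) (t : ℕ) : Type _ :=
  (∀ k : V, Fin (n k t) → ℝ) × (∀ e : E, Fin (nE e t) → ℝ)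

/-- The stacked vector `(x^(k)(t), x_in^(k)(t))`. -/
def stackIn {t : ℕ} (x : State n nE t) (k : V) : InIdx n nE k t → ℝ :=
  Sum.elim (x.1 k) (fun p => x.2 p.1.1 p.2)

/-- The states of the system driven by the input `u` from zero initial conditions. The temporal
state of `k` at time `t + 1` is the first block of `A^(k)(t) (x^(k)(t), x_in^(k)(t)) + B^(k)(t)
u^(k)(t)`, and the spatial state of an edge is the block of that edge in the same vector for the
vertex at which the edge starts. -/
noncomputable def Realization.state (G : Realization E n nE nu ny) (u : Signal nu) :
    (t : ℕ) → State n nE t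
  | 0 => 0
  | t + 1 =>
    let next : ∀ k : V, OutIdx n nE k (t + 1) → ℝ := fun k =>
      G.A k t *ᵥ stackIn (G.state u t) k + G.B k t *ᵥ u k t
    (fun k i => next k (Sum.inl i), fun e i => next e.1.1 (Sum.inr ⟨⟨e, rfl⟩, i⟩))

/-- The input-output map of the system. -/
noncomputable def Realization.output (G : Realization E n nE nu ny) (u : Signal nu) : Signal ny :=
  fun k t => G.C k t *ᵥ stackIn (G.state u t) k + G.D k t *ᵥ u k t

/-- The state-space matrices are uniformly bounded (in spectral norm). -/
def Realization.UniformlyBounded (G : Realization E n nE nu ny) : Prop :=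
  ∃ c : ℝ, ∀ (k : V) (t : ℕ), ‖G.A k t‖ ≤ c ∧ ‖G.B k t‖ ≤ c ∧ ‖G.C k t‖ ≤ c ∧ ‖G.D k t‖ ≤ c

/-- Families of square matrices `X^(k)(t)`, one for each vertex and time. -/
abbrev VertexFamily (n : V → ℕ → ℕ) : Type _ :=
  ∀ (k : V) (t : ℕ), Matrix (Fin (n k t)) (Fin (n k t)) ℝ

/-- Families of square matrices `X^(ij)(t)`, one for each edge and time. -/
abbrev EdgeFamily (nE : E → ℕ → ℕ) : Type _ :=
  ∀ (e : E) (t : ℕ), Matrix (Fin (nE e t)) (Fin (nE e t)) ℝ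

/-- `diag(X^(k)(t), X_in^(k)(t))`. -/
def diagIn (X : VertexFamily n) (XE : EdgeFamily nE) (k : V) (t : ℕ) :
    Matrix (InIdx n nE k t) (InIdx n nE k t) ℝ :=
  Matrix.fromBlocks (X k t) 0 0 (Matrix.blockDiagonal' fun e : InEdge E k => XE e.1 t)

/-- `diag(X^(k)(t), X_out^(k)(t))`. -/
def diagOut (X : VertexFamily n) (XE : EdgeFamily nE) (k : V) (t : ℕ) :
    Matrix (OutIdx n nE k t) (OutIdx n nE k t) ℝ :=
  Matrix.fromBlocks (X k t) 0 0 (Matrix.blockDiagonal' fun e : OutEdge E k => XE e.1 t)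

/-- The families are uniformly bounded (in spectral norm), and `X^(k)(t) ≻ β I`,
`X^(ij)(t) ≻ β I` for all times, vertices and edges. -/
def BoundedAndAbove (β : ℝ) (X : VertexFamily n) (XE : EdgeFamily nE) : Prop :=
  (∃ c : ℝ, (∀ k t, ‖X k t‖ ≤ c) ∧ ∀ e t, ‖XE e t‖ ≤ c) ∧
  (∀ k t, (X k t - β • 1).PosDef) ∧ ∀ e t, (XE e t - β • 1).PosDef

/-- `(X, XE)` are controllability generalized gramians of `G`: for some `β > 0` they are uniformly
bounded, `≻ β I`, and `A diag(X, X_in) Aᵀ - diag(X, X_out)(t + 1) + B Bᵀ ≺ -β I`. -/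
def Realization.IsControllabilityGramian (G : Realization E n nE nu ny)
    (X : VertexFamily n) (XE : EdgeFamily nE) : Prop :=
  ∃ β : ℝ, 0 < β ∧ BoundedAndAbove β X XE ∧ ∀ k t,
    (-(β • 1) - (G.A k t * diagIn X XE k t * (G.A k t)ᵀ - diagOut X XE k (t + 1)
      + G.B k t * (G.B k t)ᵀ)).PosDef

/-- `(Y, YE)` are observability generalized gramians of `G`: for some `β > 0` they are uniformly
bounded, `≻ β I`, and `Aᵀ diag(Y, Y_out)(t + 1) A - diag(Y, Y_in) + Cᵀ C ≺ -β I`. -/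
def Realization.IsObservabilityGramian (G : Realization E n nE nu ny)
    (Y : VertexFamily n) (YE : EdgeFamily nE) : Prop :=
  ∃ β : ℝ, 0 < β ∧ BoundedAndAbove β Y YE ∧ ∀ k t,
    (-(β • 1) - ((G.A k t)ᵀ * diagOut Y YE k (t + 1) * G.A k t - diagIn Y YE k t
      + (G.C k t)ᵀ * G.C k t)).PosDef

/-- The realization `G` is balanced, with balanced generalized gramians `(S, SE)`. -/
def Realization.IsBalanced (G : Realization E n nE nu ny)
    (S : VertexFamily n) (SE : EdgeFamily nE) : Prop :=
  (∀ k t, (S k t).IsDiag) ∧ (∀ e t, (SE e t).IsDiag) ∧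
  G.IsControllabilityGramian S SE ∧ G.IsObservabilityGramian S SE

/-- The non-truncated coordinates of `(x^(k)(t), x_in^(k)(t))`: the leading ones of each block. -/
def keepIn {r : V → ℕ → ℕ} {rE : E → ℕ → ℕ} (hr : ∀ k t, r k t ≤ n k t)
    (hrE : ∀ e t, rE e t ≤ nE e t) (k : V) (t : ℕ) : InIdx r rE k t → InIdx n nE k t :=
  Sum.map (Fin.castLE (hr k t)) fun p => ⟨p.1, Fin.castLE (hrE p.1.1 t) p.2⟩

/-- The non-truncated coordinates of `(x^(k)(t), x_out^(k)(t))`: the leading ones of each block. -/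
def keepOut {r : V → ℕ → ℕ} {rE : E → ℕ → ℕ} (hr : ∀ k t, r k t ≤ n k t)
    (hrE : ∀ e t, rE e t ≤ nE e t) (k : V) (t : ℕ) : OutIdx r rE k t → OutIdx n nE k t :=
  Sum.map (Fin.castLE (hr k t)) fun p => ⟨p.1, Fin.castLE (hrE p.1.1 t) p.2⟩

/-- The reduced order realization of dimensions `r`, `rE`. -/
def Realization.truncate (G : Realization E n nE nu ny) {r : V → ℕ → ℕ} {rE : E → ℕ → ℕ}
    (hr : ∀ k t, r k t ≤ n k t) (hrE : ∀ e t, rE e t ≤ nE e t) : Realization E r rE nu ny where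
  A k t := (G.A k t).submatrix (keepOut hr hrE k (t + 1)) (keepIn hr hrE k t)
  B k t := (G.B k t).submatrix (keepOut hr hrE k (t + 1)) id
  C k t := (G.C k t).submatrix id (keepIn hr hrE k t)
  D k t := G.D k t

/-- Truncated coordinates at time `t`: those of all vertices, then those of all edges. -/
abbrev TruncIdx (n r : V → ℕ → ℕ) (nE rE : E → ℕ → ℕ) (t : ℕ) : Type _ :=
  (Σ k : V, {i : Fin (n k t) // r k t ≤ (i : ℕ)}) ⊕
    (Σ e : E, {i : Fin (nE e t) // rE e t ≤ (i : ℕ)})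

/-- The possibly infinite block-diagonal matrix `Ω`, whose diagonal blocks are the trailing blocks
`Ω^(k)(t)`, `Ω^(ij)(t)` of `S^(k)(t)`, `S^(ij)(t)` that belong to the truncated coordinates. -/
def Omega (r : V → ℕ → ℕ) (rE : E → ℕ → ℕ) (S : VertexFamily n) (SE : EdgeFamily nE) :
    Matrix (Σ t : ℕ, TruncIdx n r nE rE t) (Σ t : ℕ, TruncIdx n r nE rE t) ℝ :=
  Matrix.blockDiagonal' fun t => Matrix.fromBlocks
    (Matrix.blockDiagonal' fun k =>
      (S k t).submatrix (fun i : {i : Fin (n k t) // r k t ≤ (i : ℕ)} => i.1) (fun i => i.1))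
    0 0
    (Matrix.blockDiagonal' fun e =>
      (SE e t).submatrix (fun i : {i : Fin (nE e t) // rE e t ≤ (i : ℕ)} => i.1) (fun i => i.1))

end Defs

/-- The sum, possibly infinite, of the distinct diagonal entries of a matrix with nonnegative
diagonal. -/
noncomputable def zeta {ι : Type*} (M : Matrix ι ι ℝ) : ℝ≥0∞ :=
  ∑' q : Set.range M.diag, ENNReal.ofReal (q : ℝ)

end DistSys

/-! All vertices are merged into one time-varying system: each state coordinate enters exactly one
vertex and is produced by exactly one, so the local Lyapunov inequalities add up to global
dissipation inequalities with weights `s`, the diagonal entries of the gramians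
(`Realization.IsBalanced.exists_dissipative`). Truncation becomes resetting the dropped coordinates
to zero at every step, so all reduced systems share one state space. If `x` and `z` are trajectories
whose kept sets differ only in coordinates of weight `σ`, then `∑ s (x - z)² + σ² ∑ (x + z)² / s` is
a storage function: observability controls `x - z`, which sees no input, and controllability
controls `x + z`, which is driven by `2u`. This gives the error bound `2σ√q`
(`LTV.Dissipative.sum_truncation_error_le`). Removing the distinct weights one at a time and
applying Minkowski's inequality yields `2√q ζ(Ω)`. The factor `q < 1` comes from the margin `-βI` in
the controllability inequality and makes the final inequality strict. If `Ω` has infinitely many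
distinct diagonal entries, then `ζ(Ω) = ∞` and only finiteness is needed, which follows from `q < 1`
(`LTV.Dissipative.sum_output_le`). -/

namespace DistSys

/-! ### Lyapunov matrix inequalities as scalar dissipation inequalities. -/

section QuadraticForms

variable {m n p : Type*} [Fintype m] [Fintype n] [Fintype p]

theorem dotProduct_mul_diagonal_mul_transpose [DecidableEq n] (M : Matrix m n ℝ) (s : n → ℝ)
    (v : m → ℝ) :
    v ⬝ᵥ ((M * Matrix.diagonal s * Mᵀ) *ᵥ v) = ∑ j, s j * (Mᵀ *ᵥ v) j ^ 2 := by
  rw [← Matrix.mulVec_mulVec, ← Matrix.mulVec_mulVec, Matrix.dotProduct_mulVec,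
    ← Matrix.mulVec_transpose]
  simp only [dotProduct, Matrix.mulVec_diagonal]
  exact Finset.sum_congr rfl fun j _ => by ring

theorem dotProduct_mul_transpose_self (M : Matrix m n ℝ) (v : m → ℝ) :
    v ⬝ᵥ ((M * Mᵀ) *ᵥ v) = ∑ j, (Mᵀ *ᵥ v) j ^ 2 := by
  classical
  have := dotProduct_mul_diagonal_mul_transpose M (fun _ => 1) v
  simpa using this

theorem dotProduct_diagonal_mulVec [DecidableEq m] (s v : m → ℝ) :
    v ⬝ᵥ (Matrix.diagonal s *ᵥ v) = ∑ j, s j * v j ^ 2 := by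
  simp only [dotProduct, Matrix.mulVec_diagonal]
  exact Finset.sum_congr rfl fun j _ => by ring

theorem dotProduct_smul_one_mulVec [DecidableEq m] (β : ℝ) (v : m → ℝ) :
    v ⬝ᵥ ((β • (1 : Matrix m m ℝ)) *ᵥ v) = β * ∑ j, v j ^ 2 := by
  rw [Matrix.smul_mulVec, Matrix.one_mulVec, dotProduct_smul, smul_eq_mul]
  simp only [dotProduct, sq]

/-- A strict controllability Lyapunov inequality makes `(x, u) ↦ M x + B u` a strict contraction
in the norms weighted by the inverse gramians. -/
theorem sum_sq_div_le_of_lyapunov [DecidableEq m] [DecidableEq n] {M : Matrix m n ℝ}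
    {B : Matrix m p ℝ} {s : n → ℝ} {s' : m → ℝ} {β c : ℝ} (hβ : 0 < β) (hc : 2 * β ≤ c)
    (hs : ∀ j, 0 < s j) (hs' : ∀ i, 0 < s' i) (hsc : ∀ i, s' i ≤ c)
    (H : (-(β • 1) - (M * Matrix.diagonal s * Mᵀ - Matrix.diagonal s' + B * Bᵀ)).PosDef)
    (x : n → ℝ) (u : p → ℝ) :
    ∑ i, (M *ᵥ x + B *ᵥ u) i ^ 2 / s' i ≤
      (1 - β / c) * (∑ j, x j ^ 2 / s j + ∑ l, u l ^ 2) := by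
  set w := M *ᵥ x + B *ᵥ u with hw
  -- The controllability inequality lives on the dual side. Testing it on `v = S'⁻¹ w` gives `⟨v, w⟩
  -- = ⟨v, S' v⟩ = Q`.
  set v : m → ℝ := fun i => w i / s' i with hv
  set Q := ∑ i, w i ^ 2 / s' i with hQ
  have hcpos : 0 < c := by linarith
  set q := 1 - β / c with hq
  have hq0 : 0 < q := by
    -- The assumption `2β ≤ c` keeps `q` away from zero, so that division by `q` is possible.
    have : β / c ≤ 1 / 2 := by rw [div_le_iff₀ hcpos]; linarith
    simp only [hq]; linarith
  have hH := H.posSemidef.dotProduct_mulVec_nonneg v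
  simp only [star_trivial, Matrix.sub_mulVec, Matrix.add_mulVec, Matrix.neg_mulVec, dotProduct_sub,
    dotProduct_add, dotProduct_neg, dotProduct_mul_diagonal_mul_transpose,
    dotProduct_mul_transpose_self, dotProduct_diagonal_mulVec, dotProduct_smul_one_mulVec] at hH
  have h1 : ∑ i, s' i * v i ^ 2 = Q := by
    refine Finset.sum_congr rfl fun i _ => ?_
    have := (hs' i).ne'
    simp only [hv]; field_simp
  have h2 : Q / c ≤ ∑ i, v i ^ 2 := by
    rw [hQ, Finset.sum_div]
    refine Finset.sum_le_sum fun i _ => ?_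
    have h := hs' i
    simp only [hv]
    rw [div_pow, div_div]
    exact div_le_div_of_nonneg_left (sq_nonneg _) (by positivity) (by nlinarith [hsc i])
  have h3 : Q = ∑ j, (Mᵀ *ᵥ v) j * x j + ∑ l, (Bᵀ *ᵥ v) l * u l := by
    have e1 : Q = v ⬝ᵥ w := Finset.sum_congr rfl fun i _ => by simp only [hv]; ring
    rw [e1, hw, dotProduct_add, Matrix.dotProduct_mulVec, Matrix.dotProduct_mulVec,
      ← Matrix.mulVec_transpose, ← Matrix.mulVec_transpose]
    rfl
  -- The parameter `q` is tuned so that the dual terms divided by `q` total at most `Q` (`h6`, where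
  -- the margin `β` is spent). Then `2Q ≤ Q + q (...)`.
  have amgm : ∀ a b : ℝ, 2 * (a * b) ≤ a ^ 2 / q + q * b ^ 2 := fun a b => by
    have : a ^ 2 / q + q * b ^ 2 - 2 * (a * b) = (a - q * b) ^ 2 / q := by field_simp; ring
    have h : 0 ≤ (a - q * b) ^ 2 / q := by positivity
    linarith
  have h4 : 2 * ∑ j, (Mᵀ *ᵥ v) j * x j ≤
      (∑ j, s j * (Mᵀ *ᵥ v) j ^ 2) / q + q * ∑ j, x j ^ 2 / s j := by
    rw [Finset.mul_sum, Finset.sum_div, Finset.mul_sum, ← Finset.sum_add_distrib]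
    refine Finset.sum_le_sum fun j _ => ?_
    have hj := hs j
    have h := amgm (s j * (Mᵀ *ᵥ v) j) (x j)
    have e : s j * (Mᵀ *ᵥ v) j ^ 2 / q + q * (x j ^ 2 / s j) - 2 * ((Mᵀ *ᵥ v) j * x j) =
      ((s j * (Mᵀ *ᵥ v) j) ^ 2 / q + q * x j ^ 2 - 2 * (s j * (Mᵀ *ᵥ v) j * x j)) / s j := by
      field_simp
    have h' : 0 ≤ ((s j * (Mᵀ *ᵥ v) j) ^ 2 / q + q * x j ^ 2 -
      2 * (s j * (Mᵀ *ᵥ v) j * x j)) / s j := div_nonneg (by linarith) hj.le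
    linarith
  have h5 : 2 * ∑ l, (Bᵀ *ᵥ v) l * u l ≤
      (∑ l, (Bᵀ *ᵥ v) l ^ 2) / q + q * ∑ l, u l ^ 2 := by
    rw [Finset.mul_sum, Finset.sum_div, Finset.mul_sum, ← Finset.sum_add_distrib]
    exact Finset.sum_le_sum fun l _ => amgm _ _
  have h6 : (∑ j, s j * (Mᵀ *ᵥ v) j ^ 2) / q + (∑ l, (Bᵀ *ᵥ v) l ^ 2) / q ≤ Q := by
    rw [← add_div, div_le_iff₀ hq0]
    have : β * (Q / c) ≤ β * ∑ i, v i ^ 2 := mul_le_mul_of_nonneg_left h2 hβ.le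
    have e : Q * q = Q - β * (Q / c) := by simp only [hq]; ring
    linarith
  linarith

/-- The dissipation inequality of an observability Lyapunov inequality. -/
theorem sum_sq_add_sum_sq_le_of_lyapunov [DecidableEq m] [DecidableEq n] {M : Matrix m n ℝ}
    {C : Matrix p n ℝ} {s : n → ℝ} {s' : m → ℝ} {β : ℝ} (hβ : 0 < β)
    (H : (-(β • 1) - (Mᵀ * Matrix.diagonal s' * M - Matrix.diagonal s + Cᵀ * C)).PosDef)
    (x : n → ℝ) :
    ∑ i, s' i * (M *ᵥ x) i ^ 2 + ∑ l, (C *ᵥ x) l ^ 2 ≤ ∑ j, s j * x j ^ 2 := by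
  have hH := H.posSemidef.dotProduct_mulVec_nonneg x
  have e1 := dotProduct_mul_diagonal_mul_transpose Mᵀ s' x
  have e2 := dotProduct_mul_transpose_self Cᵀ x
  rw [Matrix.transpose_transpose] at e1 e2
  simp only [star_trivial, Matrix.sub_mulVec, Matrix.add_mulVec, Matrix.neg_mulVec, dotProduct_sub,
    dotProduct_add, dotProduct_neg, e1, e2, dotProduct_diagonal_mulVec,
    dotProduct_smul_one_mulVec] at hH
  have : 0 ≤ β * ∑ j, x j ^ 2 := by positivity
  linarith

end QuadraticForms

/-- Minkowski's inequality for finite sums of squares. -/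
theorem sum_add_sq_le {ι : Type*} {s : Finset ι} {f g : ι → ℝ} {a b W : ℝ} (ha : 0 ≤ a)
    (hb : 0 ≤ b) (hW : 0 ≤ W) (hf : ∑ i ∈ s, f i ^ 2 ≤ a ^ 2 * W)
    (hg : ∑ i ∈ s, g i ^ 2 ≤ b ^ 2 * W) :
    ∑ i ∈ s, (f i + g i) ^ 2 ≤ (a + b) ^ 2 * W := by
  have h : (∑ i ∈ s, f i * g i) ^ 2 ≤ (a * b * W) ^ 2 := by
    refine (Finset.sum_mul_sq_le_sq_mul_sq s f g).trans ?_
    calc _ ≤ (a ^ 2 * W) * (b ^ 2 * W) :=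
          mul_le_mul hf hg (Finset.sum_nonneg fun i _ => sq_nonneg _) (by positivity)
      _ = _ := by ring
  have h' := abs_le_of_sq_le_sq' h (by positivity)
  have e : ∑ i ∈ s, (f i + g i) ^ 2 =
      ∑ i ∈ s, f i ^ 2 + 2 * ∑ i ∈ s, f i * g i + ∑ i ∈ s, g i ^ 2 := by
    rw [Finset.mul_sum, ← Finset.sum_add_distrib, ← Finset.sum_add_distrib]
    exact Finset.sum_congr rfl fun i _ => by ring
  rw [e]
  linarith [h'.2]

/-! ### Truncation error of a time-varying system. -/

/-- A linear time-varying system with state coordinates `ι t`, input coordinates `μ t` and output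
coordinates `ν t` at time `t`, and without feedthrough. -/
structure LTV (ι μ ν : ℕ → Type*) where
  A : ∀ t, (ι t → ℝ) →ₗ[ℝ] (ι (t + 1) → ℝ)
  B : ∀ t, (μ t → ℝ) →ₗ[ℝ] (ι (t + 1) → ℝ)
  C : ∀ t, (ι t → ℝ) →ₗ[ℝ] (ν t → ℝ)

namespace LTV

variable {ι μ ν : ℕ → Type*}

/-- The state trajectory, from zero, of the system in which the coordinates outside of `K` are
reset to zero in each step. -/
noncomputable def state (F : LTV ι μ ν) (K : ∀ t, Set (ι t)) (u : ∀ t, μ t → ℝ) :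
    ∀ t, ι t → ℝ
  | 0 => 0
  | t + 1 => (K (t + 1)).indicator (F.A t (F.state K u t) + F.B t (u t))

theorem state_eq_zero (F : LTV ι μ ν) (K : ∀ t, Set (ι t)) (u : ∀ t, μ t → ℝ) (t : ℕ) {i : ι t}
    (hi : i ∉ K t) : F.state K u t i = 0 := by
  cases t with
  | zero => rfl
  | succ t => exact Set.indicator_of_notMem hi _

variable [∀ t, Fintype (ι t)] [∀ t, Fintype (μ t)] [∀ t, Fintype (ν t)]

/-- The weights `s` are balanced gramians of the system, in the form of dissipation inequalities. -/
structure Dissipative (F : LTV ι μ ν) (s : ∀ t, ι t → ℝ) (q : ℝ) : Prop where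
  pos : ∀ t i, 0 < s t i
  ctrb : ∀ t x u, ∑ i, (F.A t x + F.B t u) i ^ 2 / s (t + 1) i ≤
    q * (∑ j, x j ^ 2 / s t j + ∑ l, u l ^ 2)
  obsv : ∀ t x, ∑ i, s (t + 1) i * F.A t x i ^ 2 + ∑ l, F.C t x l ^ 2 ≤ ∑ j, s t j * x j ^ 2

variable {F : LTV ι μ ν} {s : ∀ t, ι t → ℝ} {q : ℝ}

/-- Truncating coordinates of equal weight `σ` costs at most `2 σ √q`. -/
theorem Dissipative.sum_truncation_error_le (hF : F.Dissipative s q) (hq1 : q ≤ 1)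
    {K L : ∀ t, Set (ι t)} (hLK : ∀ t, L t ⊆ K t) {σ : ℝ}
    (hσ : ∀ t, ∀ i ∈ K t, i ∉ L t → s t i = σ) (u : ∀ t, μ t → ℝ) (N : ℕ) :
    ∑ t ∈ Finset.range N, ∑ l, F.C t (F.state K u t - F.state L u t) l ^ 2 ≤
      4 * σ ^ 2 * q * ∑ t ∈ Finset.range N, ∑ l, u t l ^ 2 := by
  classical
  set x := F.state K u with hx
  set z := F.state L u with hz
  let V : ℕ → ℝ := fun t =>
    ∑ i, (s t i * (x t - z t) i ^ 2 + σ ^ 2 * ((x t + z t) i ^ 2 / s t i))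
  have hV0 : V 0 = 0 := by simp [V, hx, hz, state]
  have hVnn : ∀ t, 0 ≤ V t := fun t => Finset.sum_nonneg fun i _ => by
    have := hF.pos t i
    positivity
  have step : ∀ t, V (t + 1) + ∑ l, F.C t (x t - z t) l ^ 2 ≤
      V t + 4 * σ ^ 2 * q * ∑ l, u t l ^ 2 := by
    intro t
    have ho := hF.obsv t (x t - z t)
    -- Both trajectories are driven by `u`, so their sum is driven by `2u`; hence the factor 4.
    have hc := hF.ctrb t (x t + z t) ((2 : ℝ) • u t)
    have hu : ∑ l, ((2 : ℝ) • u t) l ^ 2 = 4 * ∑ l, u t l ^ 2 := by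
      rw [Finset.mul_sum]
      exact Finset.sum_congr rfl fun l _ => by simp only [Pi.smul_apply, smul_eq_mul]; ring
    rw [hu] at hc
    have key : V (t + 1) ≤ ∑ i, s (t + 1) i * F.A t (x t - z t) i ^ 2 + σ ^ 2 *
        ∑ i, (F.A t (x t + z t) + F.B t ((2 : ℝ) • u t)) i ^ 2 / s (t + 1) i := by
      rw [Finset.mul_sum, ← Finset.sum_add_distrib]
      refine Finset.sum_le_sum fun i _ => ?_
      have hp := hF.pos (t + 1) i
      have ex : x (t + 1) i = if i ∈ K (t + 1) then F.A t (x t) i + F.B t (u t) i else 0 := by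
        simp only [hx, state, Set.indicator_apply, Pi.add_apply]
      have ez : z (t + 1) i = if i ∈ L (t + 1) then F.A t (z t) i + F.B t (u t) i else 0 := by
        simp only [hz, state, Set.indicator_apply, Pi.add_apply]
      simp only [Pi.sub_apply, Pi.add_apply, map_sub, map_add, map_smul, Pi.smul_apply,
        smul_eq_mul, ex, ez]
      generalize F.A t (x t) i = a
      generalize F.A t (z t) i = b
      generalize F.B t (u t) i = d
      by_cases hL : i ∈ L (t + 1)
      · have hK := hLK _ hL
        simp only [hL, hK, if_true]
        apply le_of_eq
        ring
      · by_cases hK : i ∈ K (t + 1)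
        · have hs := hσ _ i hK hL
          rw [hs] at hp ⊢
          simp only [hL, hK, if_true, if_false, sub_zero, add_zero]
          -- Here `z` is reset to zero while `x` is not. Since `s = σ`, the two parts of the storage
          -- function carry the same weight, and the parallelogram law for `a + d` and `b + d` shows
          -- that the reset does not increase it.
          have e : σ * (a - b) ^ 2 + σ ^ 2 * ((a + b + 2 * d) ^ 2 / σ) -
              (σ * (a + d) ^ 2 + σ ^ 2 * ((a + d) ^ 2 / σ)) = 2 * σ * (b + d) ^ 2 := by
            field_simp
            ring
          have : 0 ≤ 2 * σ * (b + d) ^ 2 := by positivity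
          linarith
        · simp only [hL, hK, if_false, sub_zero, add_zero]
          have h1 : 0 ≤ s (t + 1) i * (a - b) ^ 2 := by positivity
          have h2 : 0 ≤ σ ^ 2 * ((a + b + 2 * d) ^ 2 / s (t + 1) i) := by positivity
          simpa using add_nonneg h1 h2
    have hV : V t = ∑ j, s t j * (x t - z t) j ^ 2 +
        σ ^ 2 * ∑ j, (x t + z t) j ^ 2 / s t j := by
      rw [Finset.mul_sum, ← Finset.sum_add_distrib]
    have hnn : 0 ≤ ∑ j, (x t + z t) j ^ 2 / s t j := Finset.sum_nonneg fun i _ => by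
      have := hF.pos t i
      positivity
    have h1 := mul_le_mul_of_nonneg_left hc (sq_nonneg σ)
    have h2 : q * ∑ j, (x t + z t) j ^ 2 / s t j ≤ ∑ j, (x t + z t) j ^ 2 / s t j :=
      mul_le_of_le_one_left hnn hq1
    -- The contraction is given up on the state term and kept only on the input term.
    have h3 := mul_le_mul_of_nonneg_left h2 (sq_nonneg σ)
    rw [hV]
    linarith
  have acc : V N + ∑ t ∈ Finset.range N, ∑ l, F.C t (x t - z t) l ^ 2 ≤
      4 * σ ^ 2 * q * ∑ t ∈ Finset.range N, ∑ l, u t l ^ 2 := by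
    induction N with
    | zero => simp [hV0]
    | succ N ih =>
      rw [Finset.sum_range_succ, Finset.sum_range_succ, mul_add]
      linarith [step N]
  linarith [hVnn N]

/-- Truncating coordinates whose weights lie in a finite set `P` costs at most twice the sum
of `P`, times `√q`. -/
theorem Dissipative.sum_truncation_error_le_of_finset (hF : F.Dissipative s q) (hq0 : 0 ≤ q)
    (hq1 : q ≤ 1) (L : ∀ t, Set (ι t)) (P : Finset ℝ) (hP : ∀ σ ∈ P, 0 ≤ σ)
    (u : ∀ t, μ t → ℝ) (N : ℕ) :
    ∑ t ∈ Finset.range N, ∑ l, F.C t (F.state (fun _ => Set.univ) u t -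
        F.state (fun t => {i | i ∈ L t ∨ s t i ∉ P}) u t) l ^ 2 ≤
      (2 * √q * ∑ σ ∈ P, σ) ^ 2 * ∑ t ∈ Finset.range N, ∑ l, u t l ^ 2 := by
  classical
  induction P using Finset.induction_on with
  | empty => simp
  | insert σ P hσ ih =>
    have hP' : ∀ σ ∈ P, 0 ≤ σ := fun τ h => hP τ (Finset.mem_insert_of_mem h)
    have h1 := ih hP'
    have h2 := hF.sum_truncation_error_le hq1 (K := fun t => {i | i ∈ L t ∨ s t i ∉ P})
      (L := fun t => {i | i ∈ L t ∨ s t i ∉ insert σ P}) (σ := σ)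
      (fun t i hi => hi.imp id fun h h' => h (Finset.mem_insert_of_mem h'))
      (fun t i hi hi' => by
        simp only [Set.mem_ofPred_eq, Finset.mem_insert] at hi hi'
        tauto) u N
    have e : 4 * σ ^ 2 * q = (2 * √q * σ) ^ 2 := by
      rw [mul_pow, mul_pow, Real.sq_sqrt hq0]; ring
    rw [e] at h2
    have h0 : 0 ≤ σ := hP σ (Finset.mem_insert_self _ _)
    rw [Finset.sum_insert hσ, mul_add, add_comm (2 * √q * σ)]
    -- Time and output coordinate are merged into one index so that Minkowski's inequality applies.
    rw [Finset.sum_sigma'] at h1 h2 ⊢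
    have hs : 0 ≤ ∑ σ ∈ P, σ := Finset.sum_nonneg hP'
    refine le_trans (le_of_eq ?_) (sum_add_sq_le (by positivity) (by positivity)
      (Finset.sum_nonneg fun t _ => Finset.sum_nonneg fun l _ => sq_nonneg _) h1 h2)
    refine Finset.sum_congr rfl fun p _ => ?_
    rw [← Pi.add_apply, ← map_add, sub_add_sub_cancel]

/-- The energy `V = ∑ x² / s` satisfies `V(t+1) ≤ q (V(t) + |u(t)|²)`, and resetting coordinates
only lowers it. Summation over time bounds `∑ V`, and the output obeys `|C x|² ≤ ∑ s x² ≤ c² V`. No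
weights are counted, so this also serves the case `ζ(Ω) = ∞`. -/
theorem Dissipative.sum_output_le (hF : F.Dissipative s q) (hq1 : q < 1) {c : ℝ}
    (hc : ∀ t i, s t i ≤ c) (K : ∀ t, Set (ι t)) (u : ∀ t, μ t → ℝ) (N : ℕ) :
    ∑ t ∈ Finset.range N, ∑ l, F.C t (F.state K u t) l ^ 2 ≤
      c ^ 2 * (q / (1 - q)) * ∑ t ∈ Finset.range N, ∑ l, u t l ^ 2 := by
  classical
  set x := F.state K u with hx
  let V : ℕ → ℝ := fun t => ∑ i, x t i ^ 2 / s t i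
  have hVnn : ∀ t, 0 ≤ V t := fun t => Finset.sum_nonneg fun i _ => by
    have := hF.pos t i
    positivity
  have hV0 : V 0 = 0 := by simp [V, hx, state]
  have step : ∀ t, V (t + 1) ≤ q * (V t + ∑ l, u t l ^ 2) := fun t => by
    refine le_trans (Finset.sum_le_sum fun i _ => ?_) (hF.ctrb t (x t) (u t))
    have hp := hF.pos (t + 1) i
    by_cases h : i ∈ K (t + 1)
    · simp [hx, state, h]
    · simp only [hx, state, Set.indicator_of_notMem h]
      rw [zero_pow two_ne_zero, zero_div]
      positivity
  have acc : V N + (1 - q) * ∑ t ∈ Finset.range N, V t ≤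
      q * ∑ t ∈ Finset.range N, ∑ l, u t l ^ 2 := by
    induction N with
    | zero => simp [hV0]
    | succ N ih =>
      rw [Finset.sum_range_succ, Finset.sum_range_succ, mul_add, mul_add]
      linarith [step N]
  have out : ∀ t, ∑ l, F.C t (x t) l ^ 2 ≤ c ^ 2 * V t := fun t => by
    have h1 := hF.obsv t (x t)
    have h2 : 0 ≤ ∑ i, s (t + 1) i * F.A t (x t) i ^ 2 := Finset.sum_nonneg fun i _ => by
      have := hF.pos (t + 1) i
      positivity
    have h3 : ∑ j, s t j * x t j ^ 2 ≤ c ^ 2 * V t := by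
      rw [Finset.mul_sum]
      refine Finset.sum_le_sum fun i _ => ?_
      have hp := hF.pos t i
      have h4 : s t i ^ 2 ≤ c ^ 2 := pow_le_pow_left₀ hp.le (hc t i) 2
      calc s t i * x t i ^ 2 = s t i ^ 2 * (x t i ^ 2 / s t i) := by field_simp
        _ ≤ _ := mul_le_mul_of_nonneg_right h4 (by positivity)
    linarith
  have hq : 0 < 1 - q := by linarith
  calc _ ≤ ∑ t ∈ Finset.range N, c ^ 2 * V t := Finset.sum_le_sum fun t _ => out t
    _ = c ^ 2 * ∑ t ∈ Finset.range N, V t := by rw [Finset.mul_sum]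
    _ ≤ c ^ 2 * ((q * ∑ t ∈ Finset.range N, ∑ l, u t l ^ 2) / (1 - q)) := by
      refine mul_le_mul_of_nonneg_left ?_ (sq_nonneg c)
      rw [le_div_iff₀ hq]
      linarith [hVnn N]
    _ = _ := by ring

theorem Dissipative.sum_output_sub_le (hF : F.Dissipative s q) (hq1 : q < 1) {c : ℝ}
    (hc : ∀ t i, s t i ≤ c) (K L : ∀ t, Set (ι t)) (u : ∀ t, μ t → ℝ) (N : ℕ) :
    ∑ t ∈ Finset.range N, ∑ l, F.C t (F.state K u t - F.state L u t) l ^ 2 ≤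
      4 * (c ^ 2 * (q / (1 - q))) * ∑ t ∈ Finset.range N, ∑ l, u t l ^ 2 := by
  have h1 := hF.sum_output_le hq1 hc K u N
  have h2 := hF.sum_output_le hq1 hc L u N
  have h3 : ∑ t ∈ Finset.range N, ∑ l, F.C t (F.state K u t - F.state L u t) l ^ 2 ≤
      2 * ∑ t ∈ Finset.range N, ∑ l, F.C t (F.state K u t) l ^ 2 +
      2 * ∑ t ∈ Finset.range N, ∑ l, F.C t (F.state L u t) l ^ 2 := by
    simp only [Finset.mul_sum, ← Finset.sum_add_distrib]
    refine Finset.sum_le_sum fun t _ => Finset.sum_le_sum fun l _ => ?_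
    rw [map_sub, Pi.sub_apply]
    nlinarith [sq_nonneg (F.C t (F.state K u t) l + F.C t (F.state L u t) l)]
  linarith

end LTV

end DistSys

namespace DistSys

/-! ### From finite-horizon estimates to the induced norm. -/

section Norms

variable {V : Type*} [Fintype V] {d d' : V → ℕ → ℕ}

theorem tsum_ofReal_le_of_sum_range_le {e w : ℕ → ℝ} (he : ∀ t, 0 ≤ e t) (hw : ∀ t, 0 ≤ w t)
    {a : ℝ} (ha : 0 ≤ a)
    (h : ∀ N, ∑ t ∈ Finset.range N, e t ≤ a * ∑ t ∈ Finset.range N, w t) :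
    ∑' t, ENNReal.ofReal (e t) ≤ ENNReal.ofReal a * ∑' t, ENNReal.ofReal (w t) := by
  rw [ENNReal.tsum_eq_iSup_nat]
  refine iSup_le fun N => ?_
  rw [← ENNReal.ofReal_sum_of_nonneg fun t _ => he t]
  refine (ENNReal.ofReal_le_ofReal (h N)).trans ?_
  rw [ENNReal.ofReal_mul ha, ENNReal.ofReal_sum_of_nonneg fun t _ => hw t]
  gcongr
  exact ENNReal.sum_le_tsum _

theorem tsum_ofReal_dotProduct (w : Signal d) :
    ∑' p : ℕ × V, ENNReal.ofReal (w p.2 p.1 ⬝ᵥ w p.2 p.1) =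
      ∑' t, ENNReal.ofReal (∑ p : Σ k : V, Fin (d k t), w p.1 t p.2 ^ 2) := by
  rw [ENNReal.tsum_prod (f := fun t k => ENNReal.ofReal (w k t ⬝ᵥ w k t))]
  refine tsum_congr fun t => ?_
  rw [tsum_fintype, Fintype.sum_sigma, ENNReal.ofReal_sum_of_nonneg
    fun k _ => Finset.sum_nonneg fun i _ => sq_nonneg _]
  refine Finset.sum_congr rfl fun k _ => ?_
  simp only [dotProduct, sq]

/-- A bound uniform in the horizon `N` passes to the supremum of the partial sums in `[0, ∞]`, so
summability need not be discussed. -/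
theorem inducedNorm_le {T : Signal d → Signal d'} {a : ℝ} (ha : 0 ≤ a)
    (h : ∀ u N, ∑ t ∈ Finset.range N, ∑ p : Σ k : V, Fin (d' k t), T u p.1 t p.2 ^ 2 ≤
      a ^ 2 * ∑ t ∈ Finset.range N, ∑ p : Σ k : V, Fin (d k t), u p.1 t p.2 ^ 2) :
    inducedNorm T ≤ ENNReal.ofReal a := by
  refine iSup₂_le fun u _ => ENNReal.div_le_of_le_mul ?_
  simp only [l2norm, tsum_ofReal_dotProduct]
  have hnn : ∀ {d : V → ℕ → ℕ} (w : Signal d) (t : ℕ),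
      0 ≤ ∑ p : Σ k : V, Fin (d k t), w p.1 t p.2 ^ 2 :=
    fun w t => Finset.sum_nonneg fun _ _ => sq_nonneg _
  have key := tsum_ofReal_le_of_sum_range_le (hnn (T u)) (hnn u) (sq_nonneg a) (h u)
  refine (ENNReal.rpow_le_rpow key (by norm_num)).trans (le_of_eq ?_)
  rw [ENNReal.mul_rpow_of_nonneg _ _ (by norm_num),
    ENNReal.ofReal_rpow_of_nonneg (sq_nonneg a) (by norm_num), ← Real.sqrt_eq_rpow,
    Real.sqrt_sq ha]

end Norms

/-! ### The distributed system and its truncation as one time-varying system. -/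

section Global

variable {V : Type*} {E : Finset (V × V)}
  {n r : V → ℕ → ℕ} {nE rE : E → ℕ → ℕ} {nu ny : V → ℕ → ℕ}

/-- All state coordinates of the distributed system at time `t`. -/
abbrev StateIdx (n : V → ℕ → ℕ) (nE : E → ℕ → ℕ) (t : ℕ) : Type _ :=
  (Σ k : V, Fin (n k t)) ⊕ (Σ e : E, Fin (nE e t))

/-- Each state coordinate enters exactly one vertex. -/
def inEquiv (n : V → ℕ → ℕ) (nE : E → ℕ → ℕ) (t : ℕ) :
    (Σ k : V, InIdx n nE k t) ≃ StateIdx n nE t where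
  toFun p := Sum.map (fun i => ⟨p.1, i⟩) (fun i => ⟨i.1.1, i.2⟩) p.2
  invFun := Sum.elim (fun p => ⟨p.1, Sum.inl p.2⟩) (fun p => ⟨p.1.1.2, Sum.inr ⟨⟨p.1, rfl⟩, p.2⟩⟩)
  left_inv := by rintro ⟨k, i | ⟨⟨e, rfl⟩, i⟩⟩ <;> rfl
  right_inv := by rintro (⟨k, i⟩ | ⟨e, i⟩) <;> rfl

/-- The diagonal entries of all gramian blocks at time `t`. -/
def weight (S : VertexFamily n) (SE : EdgeFamily nE) (t : ℕ) : StateIdx n nE t → ℝ :=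
  Sum.elim (fun p => S p.1 t p.2 p.2) (fun p => SE p.1 t p.2 p.2)

theorem BoundedAndAbove.lt_weight {β : ℝ} {S : VertexFamily n} {SE : EdgeFamily nE}
    (h : BoundedAndAbove β S SE) (t : ℕ) (g : StateIdx n nE t) : β < weight S SE t g := by
  rcases g with ⟨k, i⟩ | ⟨e, i⟩
  · have := (h.2.1 k t).diag_pos (i := i)
    simpa [weight] using this
  · have := (h.2.2 e t).diag_pos (i := i)
    simpa [weight] using this

theorem diag_le_norm {m : Type*} [Fintype m] [DecidableEq m] {M : Matrix m m ℝ} (hM : M.IsDiag)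
    (i : m) : M i i ≤ ‖M‖ := by
  rw [← hM.diagonal_diag, Matrix.l2_opNorm_diagonal, Matrix.diagonal_apply_eq]
  exact (le_abs_self _).trans (norm_le_pi_norm M.diag i)

theorem BoundedAndAbove.exists_weight_le {β : ℝ} {S : VertexFamily n} {SE : EdgeFamily nE}
    (h : BoundedAndAbove β S SE) (hS : ∀ k t, (S k t).IsDiag) (hSE : ∀ e t, (SE e t).IsDiag) :
    ∃ c, ∀ t g, weight S SE t g ≤ c := by
  obtain ⟨c, hc, hcE⟩ := h.1
  refine ⟨c, fun t g => ?_⟩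
  rcases g with ⟨k, i⟩ | ⟨e, i⟩
  · exact (diag_le_norm (hS k t) i).trans (hc k t)
  · exact (diag_le_norm (hSE e t) i).trans (hcE e t)

/-- The state coordinates kept by the truncation to dimensions `r`, `rE`. -/
def keptSet (r : V → ℕ → ℕ) (rE : E → ℕ → ℕ) (t : ℕ) : Set (StateIdx n nE t) :=
  {g | Sum.elim (fun p => (p.2 : ℕ) < r p.1 t) (fun p => (p.2 : ℕ) < rE p.1 t) g}

theorem keepIn_injective (hr : ∀ k t, r k t ≤ n k t) (hrE : ∀ e t, rE e t ≤ nE e t) (k : V)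
    (t : ℕ) : Function.Injective (keepIn hr hrE k t) := by
  rintro (i | ⟨e, i⟩) (j | ⟨e', j⟩) h
  · simpa [keepIn] using h
  · simp [keepIn] at h
  · simp [keepIn] at h
  · simp only [keepIn, Sum.map_inr, Sum.inr.injEq, Sigma.mk.injEq] at h
    obtain ⟨rfl, h⟩ := h
    simpa using h

theorem mem_range_keepIn (hr : ∀ k t, r k t ≤ n k t) (hrE : ∀ e t, rE e t ≤ nE e t) (k : V)
    (t : ℕ) {i : InIdx n nE k t} (hi : inEquiv n nE t ⟨k, i⟩ ∈ keptSet r rE t) :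
    i ∈ Set.range (keepIn hr hrE k t) := by
  rcases i with i | ⟨e, i⟩
  · exact ⟨Sum.inl ⟨i, hi⟩, rfl⟩
  · exact ⟨Sum.inr ⟨e, ⟨i, hi⟩⟩, rfl⟩

variable [DecidableEq V]

/-- Each state coordinate is produced by exactly one vertex. -/
def outEquiv (n : V → ℕ → ℕ) (nE : E → ℕ → ℕ) (t : ℕ) :
    (Σ k : V, OutIdx n nE k t) ≃ StateIdx n nE t where
  toFun p := Sum.map (fun i => ⟨p.1, i⟩) (fun i => ⟨i.1.1, i.2⟩) p.2
  invFun := Sum.elim (fun p => ⟨p.1, Sum.inl p.2⟩) (fun p => ⟨p.1.1.1, Sum.inr ⟨⟨p.1, rfl⟩, p.2⟩⟩)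
  left_inv := by rintro ⟨k, i | ⟨⟨e, rfl⟩, i⟩⟩ <;> rfl
  right_inv := by rintro (⟨k, i⟩ | ⟨e, i⟩) <;> rfl

/-- The part of a global state vector that enters the vertex `k`. -/
def restrictIn {t : ℕ} (x : StateIdx n nE t → ℝ) (k : V) : InIdx n nE k t → ℝ :=
  fun i => x (inEquiv n nE t ⟨k, i⟩)

/-- The distributed system as a single time-varying system, without its feedthrough. -/
def Realization.toLTV (G : Realization E n nE nu ny) :
    LTV (StateIdx n nE) (fun t => Σ k : V, Fin (nu k t)) (fun t => Σ k : V, Fin (ny k t)) where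
  A t :=
    { toFun := fun x g => (G.A ((outEquiv n nE (t + 1)).symm g).1 t *ᵥ
        restrictIn x ((outEquiv n nE (t + 1)).symm g).1) ((outEquiv n nE (t + 1)).symm g).2
      map_add' := fun _ _ => funext fun _ => congrFun (Matrix.mulVec_add _ _ _) _
      map_smul' := fun _ _ => funext fun _ => congrFun (Matrix.mulVec_smul _ _ _) _ }
  B t :=
    { toFun := fun u g => (G.B ((outEquiv n nE (t + 1)).symm g).1 t *ᵥ
        fun i => u ⟨_, i⟩) ((outEquiv n nE (t + 1)).symm g).2
      map_add' := fun _ _ => funext fun _ => congrFun (Matrix.mulVec_add _ _ _) _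
      map_smul' := fun _ _ => funext fun _ => congrFun (Matrix.mulVec_smul _ _ _) _ }
  C t :=
    { toFun := fun x p => (G.C p.1 t *ᵥ restrictIn x p.1) p.2
      map_add' := fun _ _ => funext fun _ => congrFun (Matrix.mulVec_add _ _ _) _
      map_smul' := fun _ _ => funext fun _ => congrFun (Matrix.mulVec_smul _ _ _) _ }

theorem toLTV_A_outEquiv (G : Realization E n nE nu ny) {t : ℕ} (x : StateIdx n nE t → ℝ) (k : V)
    (i : OutIdx n nE k (t + 1)) :
    G.toLTV.A t x (outEquiv n nE (t + 1) ⟨k, i⟩) = (G.A k t *ᵥ restrictIn x k) i := by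
  rcases i with i | ⟨⟨e, rfl⟩, i⟩ <;> rfl

theorem toLTV_B_outEquiv (G : Realization E n nE nu ny) {t : ℕ}
    (u : (Σ k : V, Fin (nu k t)) → ℝ) (k : V) (i : OutIdx n nE k (t + 1)) :
    G.toLTV.B t u (outEquiv n nE (t + 1) ⟨k, i⟩) = (G.B k t *ᵥ fun l => u ⟨k, l⟩) i := by
  rcases i with i | ⟨⟨e, rfl⟩, i⟩ <;> rfl

theorem diagIn_eq_diagonal {S : VertexFamily n} {SE : EdgeFamily nE} (hS : ∀ k t, (S k t).IsDiag)
    (hSE : ∀ e t, (SE e t).IsDiag) (k : V) (t : ℕ) :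
    diagIn S SE k t = Matrix.diagonal (restrictIn (weight S SE t) k) := by
  ext i j
  rw [Matrix.diagonal_apply]
  rcases i with i | ⟨e, i⟩ <;> rcases j with j | ⟨e', j⟩
  · by_cases h : i = j
    · subst h; simp [diagIn, restrictIn, weight, inEquiv]
    · simpa [diagIn, h] using hS k t h
  · simp [diagIn]
  · simp [diagIn]
  · by_cases he : e = e'
    · subst he
      by_cases h : i = j
      · subst h; simp [diagIn, restrictIn, weight, inEquiv, Matrix.blockDiagonal'_apply_eq]
      · simpa [diagIn, Matrix.blockDiagonal'_apply_eq, h] using hSE e.1 t h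
    · simp [diagIn, Matrix.blockDiagonal'_apply_ne _ _ _ he, he]

theorem diagOut_eq_diagonal {S : VertexFamily n} {SE : EdgeFamily nE} (hS : ∀ k t, (S k t).IsDiag)
    (hSE : ∀ e t, (SE e t).IsDiag) (k : V) (t : ℕ) :
    diagOut S SE k t = Matrix.diagonal fun i => weight S SE t (outEquiv n nE t ⟨k, i⟩) := by
  ext i j
  rw [Matrix.diagonal_apply]
  rcases i with i | ⟨e, i⟩ <;> rcases j with j | ⟨e', j⟩
  · by_cases h : i = j
    · subst h; simp [diagOut, weight, outEquiv]
    · simpa [diagOut, h] using hS k t h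
  · simp [diagOut]
  · simp [diagOut]
  · by_cases he : e = e'
    · subst he
      by_cases h : i = j
      · subst h; simp [diagOut, weight, outEquiv, Matrix.blockDiagonal'_apply_eq]
      · simpa [diagOut, Matrix.blockDiagonal'_apply_eq, h] using hSE e.1 t h
    · simp [diagOut, Matrix.blockDiagonal'_apply_ne _ _ _ he, he]

/-- The sum over vertices of the local inequalities is global because `inEquiv` and `outEquiv` make
the incoming and outgoing stacks two partitions of the same set of state coordinates; an edge is
shared by its two ends without being counted twice. -/
theorem Realization.IsBalanced.exists_dissipative [Fintype V] {G : Realization E n nE nu ny}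
    {S : VertexFamily n} {SE : EdgeFamily nE} (h : G.IsBalanced S SE) :
    ∃ β > 0, ∃ c q : ℝ, 0 ≤ q ∧ q < 1 ∧ (∀ t g, β < weight S SE t g) ∧
      (∀ t g, weight S SE t g ≤ c) ∧ G.toLTV.Dissipative (weight S SE) q := by
  obtain ⟨hS, hSE, ⟨β, hβ, hb, hctrb⟩, ⟨β', hβ', -, hobsv⟩⟩ := h
  obtain ⟨c₀, hc₀⟩ := hb.exists_weight_le hS hSE
  -- Enlarging the upper bound to at least `2β` meets the requirement of
  -- `sum_sq_div_le_of_lyapunov`, even when there are no state coordinates.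
  have hc : 2 * β ≤ max c₀ (2 * β) := le_max_right _ _
  have hcpos : 0 < max c₀ (2 * β) := by linarith
  have hle : ∀ t g, weight S SE t g ≤ max c₀ (2 * β) := fun t g => (hc₀ t g).trans (le_max_left _ _)
  have hpos : ∀ t g, 0 < weight S SE t g := fun t g => hβ.trans (hb.lt_weight t g)
  refine ⟨β, hβ, max c₀ (2 * β), 1 - β / max c₀ (2 * β), ?_, ?_, hb.lt_weight, hle, hpos, ?_, ?_⟩
  · rw [sub_nonneg, div_le_one hcpos]
    linarith
  · have := div_pos hβ hcpos
    linarith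
  · intro t x u
    rw [← (outEquiv n nE (t + 1)).sum_comp, ← (inEquiv n nE t).sum_comp, Fintype.sum_sigma,
      Fintype.sum_sigma, Fintype.sum_sigma, ← Finset.sum_add_distrib, Finset.mul_sum]
    refine Finset.sum_le_sum fun k _ => ?_
    have H := hctrb k t
    rw [diagIn_eq_diagonal hS hSE, diagOut_eq_diagonal hS hSE] at H
    have := sum_sq_div_le_of_lyapunov hβ hc (fun j => hpos _ _) (fun i => hpos _ _)
      (fun i => hle _ _) H (restrictIn x k) (fun l => u ⟨k, l⟩)
    simp only [Pi.add_apply, toLTV_A_outEquiv, toLTV_B_outEquiv] at this ⊢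
    exact this
  · intro t x
    rw [← (outEquiv n nE (t + 1)).sum_comp, ← (inEquiv n nE t).sum_comp, Fintype.sum_sigma,
      Fintype.sum_sigma, Fintype.sum_sigma, ← Finset.sum_add_distrib]
    refine Finset.sum_le_sum fun k _ => ?_
    have H := hobsv k t
    rw [diagIn_eq_diagonal hS hSE, diagOut_eq_diagonal hS hSE] at H
    have := sum_sq_add_sum_sq_le_of_lyapunov hβ' H (restrictIn x k)
    simp only [toLTV_A_outEquiv]
    exact this

/-- Deleting columns is harmless when the vector vanishes on the deleted coordinates. This is what
identifies truncation with resetting. -/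
theorem submatrix_keepIn_mulVec {m m' : Type*} (hr : ∀ k t, r k t ≤ n k t)
    (hrE : ∀ e t, rE e t ≤ nE e t) {k : V} {t : ℕ} (M : Matrix m (InIdx n nE k t) ℝ)
    (f : m' → m) {x : StateIdx n nE t → ℝ} (hx : ∀ g ∉ keptSet r rE t, x g = 0)
    {z : InIdx r rE k t → ℝ} (hz : ∀ i, z i = restrictIn x k (keepIn hr hrE k t i)) (i : m') :
    (M.submatrix f (keepIn hr hrE k t) *ᵥ z) i = (M *ᵥ restrictIn x k) (f i) := by
  refine Fintype.sum_of_injective _ (keepIn_injective hr hrE k t) _ _ (fun j hj => ?_) fun j => ?_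
  · have : restrictIn x k j = 0 := hx _ fun h => hj (mem_range_keepIn hr hrE k t h)
    rw [this, mul_zero]
  · exact congrArg (M (f i) (keepIn hr hrE k t j) * ·) (hz j)

theorem stackIn_state (G : Realization E n nE nu ny) (u : Signal nu) (t : ℕ) (k : V) :
    stackIn (G.state u t) k =
      restrictIn (G.toLTV.state (fun _ => Set.univ) (fun t p => u p.1 t p.2) t) k := by
  -- A spatial state entering `k` was produced at the tail of its edge, so the induction hypothesis
  -- is needed at other vertices.
  induction t generalizing k with
  | zero => ext (i | i) <;> rfl
  | succ t ih =>
    have hA := fun k i => congrArg (fun v => (G.A k t *ᵥ v) i) (ih k)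
    ext (i | ⟨⟨e, rfl⟩, i⟩)
    · rw [restrictIn, LTV.state, Set.indicator_univ]
      exact congrArg₂ (· + ·) (hA k (Sum.inl i)) rfl
    · rw [restrictIn, LTV.state, Set.indicator_univ]
      exact congrArg₂ (· + ·) (hA e.1.1 (Sum.inr ⟨⟨e, rfl⟩, i⟩)) rfl

theorem stackIn_state_truncate (G : Realization E n nE nu ny) (hr : ∀ k t, r k t ≤ n k t)
    (hrE : ∀ e t, rE e t ≤ nE e t) (u : Signal nu) (t : ℕ) (k : V) (i : InIdx r rE k t) :
    stackIn ((G.truncate hr hrE).state u t) k i =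
      restrictIn (G.toLTV.state (keptSet r rE) (fun t p => u p.1 t p.2) t) k
        (keepIn hr hrE k t i) := by
  induction t generalizing k with
  | zero => rcases i with i | i <;> rfl
  | succ t ih =>
    have hA := fun k j => submatrix_keepIn_mulVec hr hrE (G.A k t) (keepOut hr hrE k (t + 1))
      (fun g => G.toLTV.state_eq_zero (keptSet r rE) (fun t p => u p.1 t p.2) t) (ih k) j
    rcases i with i | ⟨⟨e, rfl⟩, i⟩
    · have hm : inEquiv n nE (t + 1) ⟨k, keepIn hr hrE k (t + 1) (Sum.inl i)⟩ ∈
        keptSet r rE (t + 1) := i.2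
      rw [restrictIn, LTV.state, Set.indicator_of_mem hm]
      exact congrArg₂ (· + ·) (hA k (Sum.inl i)) rfl
    · have hm : inEquiv n nE (t + 1)
        ⟨e.1.2, keepIn hr hrE e.1.2 (t + 1) (Sum.inr ⟨⟨e, rfl⟩, i⟩)⟩ ∈
          keptSet r rE (t + 1) := i.2
      rw [restrictIn, LTV.state, Set.indicator_of_mem hm]
      exact congrArg₂ (· + ·) (hA e.1.1 (Sum.inr ⟨⟨e, rfl⟩, i⟩)) rfl

/-- Both systems have the same feedthrough `D`, which cancels; this is why `LTV` can omit it. -/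
theorem output_sub_output_truncate (G : Realization E n nE nu ny) (hr : ∀ k t, r k t ≤ n k t)
    (hrE : ∀ e t, rE e t ≤ nE e t) (u : Signal nu) (t : ℕ) (p : Σ k : V, Fin (ny k t)) :
    (G.output u - (G.truncate hr hrE).output u) p.1 t p.2 =
      G.toLTV.C t (G.toLTV.state (fun _ => Set.univ) (fun t p => u p.1 t p.2) t -
        G.toLTV.state (keptSet r rE) (fun t p => u p.1 t p.2) t) p := by
  have h := submatrix_keepIn_mulVec hr hrE (G.C p.1 t) id
    (fun g => G.toLTV.state_eq_zero (keptSet r rE) (fun t p => u p.1 t p.2) t)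
    (stackIn_state_truncate G hr hrE u t p.1) p.2
  have h' := congrArg (fun v => (G.C p.1 t *ᵥ v) p.2) (stackIn_state G u t p.1)
  rw [map_sub]
  exact (congrArg₂ (fun a b => (a + (G.D p.1 t *ᵥ u p.1 t) p.2) - (b + (G.D p.1 t *ᵥ u p.1 t) p.2))
    h' h).trans (add_sub_add_right_eq_sub _ _ _)

theorem range_diag_Omega (S : VertexFamily n) (SE : EdgeFamily nE) :
    Set.range (Omega r rE S SE).diag =
      {σ | ∃ t, ∃ g : StateIdx n nE t, g ∉ keptSet r rE t ∧ weight S SE t g = σ} := by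
  ext σ
  constructor
  · rintro ⟨⟨t, ⟨k, i, hi⟩ | ⟨e, i, hi⟩⟩, rfl⟩
    · exact ⟨t, Sum.inl ⟨k, i⟩, hi.not_gt, by
        simp [Omega, weight, Matrix.blockDiagonal'_apply_eq]⟩
    · exact ⟨t, Sum.inr ⟨e, i⟩, hi.not_gt, by
        simp [Omega, weight, Matrix.blockDiagonal'_apply_eq]⟩
  · rintro ⟨t, ⟨k, i⟩ | ⟨e, i⟩, hg, rfl⟩
    · exact ⟨⟨t, Sum.inl ⟨k, i, not_lt.1 hg⟩⟩, by
        simp [Omega, weight, Matrix.blockDiagonal'_apply_eq]⟩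
    · exact ⟨⟨t, Sum.inr ⟨e, i, not_lt.1 hg⟩⟩, by
        simp [Omega, weight, Matrix.blockDiagonal'_apply_eq]⟩

/-- Infinitely many terms, each at least `β > 0`, have an infinite sum. -/
theorem zeta_eq_top_of_infinite {ι : Type*} {M : Matrix ι ι ℝ} {β : ℝ} (hβ : 0 < β)
    (hM : ∀ σ ∈ Set.range M.diag, β < σ) (h : (Set.range M.diag).Infinite) : zeta M = ∞ := by
  have := h.to_subtype
  rw [eq_top_iff, ← ENNReal.tsum_const_eq_top_of_ne_zero (α := Set.range M.diag)
    (ENNReal.ofReal_pos.2 hβ).ne']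
  exact ENNReal.tsum_le_tsum fun σ => ENNReal.ofReal_le_ofReal (hM σ σ.2).le

theorem zeta_eq_sum {ι : Type*} {M : Matrix ι ι ℝ} (hM : ∀ σ ∈ Set.range M.diag, 0 ≤ σ)
    (h : (Set.range M.diag).Finite) : zeta M = ENNReal.ofReal (∑ σ ∈ h.toFinset, σ) := by
  have := Finset.tsum_subtype' h.toFinset fun σ => ENNReal.ofReal σ
  rw [h.coe_toFinset] at this
  rw [ENNReal.ofReal_sum_of_nonneg fun σ hσ => hM σ (h.mem_toFinset.1 hσ), ← this, zeta]

end Global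

end DistSys

/-! ### The error bound, by finiteness of the set of truncated weights. -/

open DistSys in
theorem mainTheorem2 {V : Type*} [Fintype V] [DecidableEq V] (E : Finset (V × V))
    (n r : V → ℕ → ℕ) (nE rE : E → ℕ → ℕ) (nu ny : V → ℕ → ℕ)
    (G : DistSys.Realization E n nE nu ny) (hG : G.UniformlyBounded)
    (S : DistSys.VertexFamily n) (SE : DistSys.EdgeFamily nE) (hS : G.IsBalanced S SE)
    (hr : ∀ k t, r k t ≤ n k t) (hrE : ∀ e t, rE e t ≤ nE e t)
    (htrunc : (∃ k t, r k t < n k t) ∨ ∃ e t, rE e t < nE e t) :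
    DistSys.inducedNorm (fun u => G.output u - (G.truncate hr hrE).output u) <
      2 * DistSys.zeta (DistSys.Omega r rE S SE) := by
  obtain ⟨β, hβ, c, q, hq0, hq1, hlt, hle, hdiss⟩ := hS.exists_dissipative
  have hrange := range_diag_Omega (r := r) (rE := rE) S SE
  have habove : ∀ σ ∈ Set.range (Omega r rE S SE).diag, β < σ := by
    rw [hrange]
    rintro _ ⟨t, g, -, rfl⟩
    exact hlt t g
  by_cases hfin : (Set.range (Omega r rE S SE).diag).Finite
  · have hP : ∀ σ ∈ hfin.toFinset, 0 < σ := fun σ hσ =>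
      hβ.trans (habove σ (hfin.mem_toFinset.1 hσ))
    have hne : hfin.toFinset.Nonempty := by
      rw [Set.Finite.toFinset_nonempty, hrange]
      rcases htrunc with ⟨k, t, h⟩ | ⟨e, t, h⟩
      -- With indices starting at zero, `r k t` is the first truncated one.
      · exact ⟨_, t, Sum.inl ⟨k, ⟨r k t, h⟩⟩, lt_irrefl (r k t), rfl⟩
      · exact ⟨_, t, Sum.inr ⟨e, ⟨rE e t, h⟩⟩, lt_irrefl (rE e t), rfl⟩
    have hsum : 0 < ∑ σ ∈ hfin.toFinset, σ := Finset.sum_pos hP hne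
    -- Every dropped coordinate has its weight in the finite set, so exhausting that set removes
    -- exactly the dropped coordinates; kept ones survive even if they share such a weight.
    have hkept : (fun t => {g : StateIdx n nE t |
        g ∈ keptSet r rE t ∨ weight S SE t g ∉ hfin.toFinset}) = keptSet r rE := by
      ext t g
      refine ⟨fun h => by_contra fun hg => ?_, Or.inl⟩
      refine h.resolve_left hg (hfin.mem_toFinset.2 ?_)
      rw [hrange]
      exact ⟨t, g, hg, rfl⟩
    have hbound : inducedNorm (fun u => G.output u - (G.truncate hr hrE).output u) ≤
        ENNReal.ofReal (2 * √q * ∑ σ ∈ hfin.toFinset, σ) := by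
      refine inducedNorm_le (by positivity) fun u N => ?_
      have h := hdiss.sum_truncation_error_le_of_finset hq0 hq1.le (keptSet r rE) hfin.toFinset
        (fun σ hσ => (hP σ hσ).le) (fun t p => u p.1 t p.2) N
      rw [hkept] at h
      simpa only [output_sub_output_truncate] using h
    refine hbound.trans_lt ?_
    rw [zeta_eq_sum (fun σ hσ => (hβ.trans (habove σ hσ)).le) hfin, ← ENNReal.ofReal_ofNat 2,
      ← ENNReal.ofReal_mul zero_le_two, ENNReal.ofReal_lt_ofReal_iff (by positivity)]
    -- Strictness: `√q < 1` multiplies a sum that is positive because something is truncated.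
    have hsq : √q < 1 := by
      rw [Real.sqrt_lt' one_pos]
      simpa using hq1
    nlinarith
  · rw [zeta_eq_top_of_infinite hβ habove hfin, ENNReal.mul_top two_ne_zero]
    have hq : 0 ≤ 4 * (c ^ 2 * (q / (1 - q))) := by
      have : 0 < 1 - q := by linarith
      positivity
    refine (inducedNorm_le (Real.sqrt_nonneg (4 * (c ^ 2 * (q / (1 - q))))) fun u N => ?_).trans_lt
      ENNReal.ofReal_lt_top
    have h := hdiss.sum_output_sub_le hq1 hle (fun _ => Set.univ) (keptSet r rE)
      (fun t p => u p.1 t p.2) N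
    rw [Real.sq_sqrt hq]
    simpa only [output_sub_output_truncate] using h
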